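/- Consider sixteen point masses in $\mathbb{R}^3$ located at the vertices of two nested cubes: eight points $q_1,\dots,q_8$ are the vertices of a cube with center $p$ (the outer cube), and the other eight are $q_{j+8}=p+t\,(q_j-p)$, $j=1,\dots,8$ (the inner cube), so that $t\in(0,1)$ is the ratio of the inner edge to the outer edge. Each vertex of the outer cube carries the same mass $\mu_1\in\mathbb{R}$ and each vertex of the inner cube carries the same mass $\mu_2\in\mathbb{R}$, with $(\mu_1,\mu_2)\neq(0,0)$ (signed masses are allowed). The configuration, with masses $m_1=\dots=m_8=\mu_1$ and $m_9=\dots=m_{16}=\mu_2$, is called central if there is a constant $c\in\mathbb{R}$ such that $$\sum_{j\neq i} m_j\left(\frac{1}{|q_j-q_i|^3}-c\right)(q_j-q_i)=0\qquad\text{for } i=1,\dots,16 .$$ Theorem. There is a $\delta$ with $0<\delta<1$, independent of the cubes and of the masses, such that in every such central configuration the masses $\mu_1$ and $\mu_2$ are nonzero and have the same sign if $t\in(0,\delta)$, and are nonzero and have opposite signs if $t\in(\delta,1)$. -/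

import Mathlib

/-- The configuration `q` with (real, possibly signed) masses `m` is central: there is a real `c`
such that `∑_{j ≠ i} m_j (1 / |q_j - q_i|³ - c) (q_j - q_i) = 0` for every `i`. -/
def IsCentralConfiguration {ι : Type*} [Fintype ι] [DecidableEq ι] {d : ℕ}
    (q : ι → EuclideanSpace ℝ (Fin d)) (m : ι → ℝ) : Prop :=
  ∃ c : ℝ, ∀ i : ι,
    ∑ j ∈ Finset.univ.erase i,
      (m j * (1 / ‖q j - q i‖ ^ 3 - c)) • (q j - q i) = 0

/-- The eight vertices `(±1, ±1, ±1)` of the standard cube, indexed by their sign patterns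
(`true` for `1`, `false` for `-1`). -/
noncomputable def cubeVertex (s : Fin 3 → Bool) : EuclideanSpace ℝ (Fin 3) :=
  WithLp.toLp 2 fun k => if s k then 1 else -1

/-- The sixteen positions `q` are the vertices of two nested cubes, the outer cube being the
left summand and the inner cube the right one, with edge ratio `t` (inner to outer): the outer
cube is an arbitrary cube in space (center `p`, edge `2 * a`, orientation `R`), and the inner cube
is its image under the homothety of ratio `t` about its center. -/
def IsNestedCubes (t : ℝ)
    (q : (Fin 3 → Bool) ⊕ (Fin 3 → Bool) → EuclideanSpace ℝ (Fin 3)) : Prop :=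
  ∃ (p : EuclideanSpace ℝ (Fin 3)) (a : ℝ)
    (R : EuclideanSpace ℝ (Fin 3) ≃ₗᵢ[ℝ] EuclideanSpace ℝ (Fin 3)),
    0 < a ∧
    (∀ s, q (Sum.inl s) = p + a • R (cubeVertex s)) ∧
    (∀ s, q (Sum.inr s) = p + t • (q (Sum.inl s) - p))

/-- The masses on two nested cubes: `μ₁` at every outer vertex, `μ₂` at every inner vertex. -/
def cubeMasses (μ₁ μ₂ : ℝ) : (Fin 3 → Bool) ⊕ (Fin 3 → Bool) → ℝ :=
  Sum.elim (fun _ => μ₁) (fun _ => μ₂)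

/-!
Let `G s` be the radial attraction of a cube on the point `s • v` of the ray through a vertex `v`,
divided by `s`. Since the vertices sum to zero, the terms with the multiplier `c` contribute the
same multiple of the position at every particle. Eliminating `c` between an outer vertex and the
inner vertex below it, and rescaling the inner cube to the outer one, leaves the single relation
`t ^ 3 * (G 1 - G t) * μ₁ = (G 1 - G t⁻¹) * μ₂`. Inside the cube `G t < G 1`, so `μ₁ * μ₂` has the
sign of `G 1 - G t⁻¹`. Outside, `G` decreases strictly from `∞` to `0`, hence takes the value `G 1`
at exactly one `s > 1`, and `δ = s⁻¹`.
-/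

open scoped RealInnerProductSpace

section RadialAttraction

variable {ι E : Type*} [Fintype ι] [NormedAddCommGroup E] [InnerProductSpace ℝ E]

/-- The attraction that unit masses at the points `v j` exert on the point `s • v i`, paired with
`v i`, counted positively towards the origin and divided by `s`. When `s = 1`, the particle at
`v i` itself contributes nothing, since `0 / 0 = 0`. -/
noncomputable def radialAttraction (v : ι → E) (i : ι) (s : ℝ) : ℝ :=
  s⁻¹ * ∑ j, ⟪s • v i - v j, v i⟫ / ‖s • v i - v j‖ ^ 3

theorem sum_inner_div_norm_cube (v : ι → E) (i : ι) {r s : ℝ} (hr : 0 < r) (hs : s ≠ 0) :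
    ∑ j, ⟪r • v j - s • v i, v i⟫ / ‖r • v j - s • v i‖ ^ 3 =
      -(s / r ^ 3 * radialAttraction v i (s / r)) := by
  rw [radialAttraction, Finset.mul_sum, Finset.mul_sum, ← Finset.sum_neg_distrib]
  refine Finset.sum_congr rfl fun j _ => ?_
  have diff_eq : r • v j - s • v i = -(r • ((s / r) • v i - v j)) := by
    rw [smul_sub, smul_smul, mul_div_cancel₀ _ hr.ne', neg_sub]
  rw [diff_eq, inner_neg_left, norm_neg, real_inner_smul_left, norm_smul,
    Real.norm_of_nonneg hr.le, mul_pow]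
  field_simp

theorem sum_inner_smul_sub {v : ι → E} (hv : ∑ j, v j = 0) (r : ℝ) (x y : E) :
    ∑ j, ⟪r • v j - x, y⟫ = -(Fintype.card ι * ⟪x, y⟫) := by
  simp [← sum_inner, Finset.sum_sub_distrib, ← Finset.smul_sum, hv, inner_neg_left,
    ← Nat.cast_smul_eq_nsmul ℝ, real_inner_smul_left]

/-- The attraction that a unit mass `w` on the unit sphere exerts on the point `s • u` of the ray
through a unit vector `u` with `⟪u, w⟫ = c`, in the direction `-u` and divided by `s`. For
`c = s = 1`, where the two points coincide, the value is `0`. -/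
noncomputable def unitSphereAttraction (c s : ℝ) : ℝ :=
  (s - c) / (s * √(s ^ 2 - 2 * c * s + 1) ^ 3)

theorem radialAttraction_eq_sum_unitSphereAttraction {v : ι → E} {i : ι}
    (hi : v i ≠ 0) (hv : ∀ j, ‖v j‖ = ‖v i‖) (s : ℝ) :
    radialAttraction v i s =
      ‖v i‖⁻¹ * ∑ j, unitSphereAttraction (⟪v i, v j⟫ / ‖v i‖ ^ 2) s := by
  rw [radialAttraction, Finset.mul_sum, Finset.mul_sum]
  refine Finset.sum_congr rfl fun j _ => ?_
  have hr : 0 < ‖v i‖ := norm_pos_iff.2 hi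
  set c := ⟪v i, v j⟫ / ‖v i‖ ^ 2
  have inner_eq : ⟪v i, v j⟫ = ‖v i‖ ^ 2 * c := (mul_div_cancel₀ _ (by positivity)).symm
  have sub_inner_eq : ⟪s • v i - v j, v i⟫ = ‖v i‖ ^ 2 * (s - c) := by
    rw [inner_sub_left, real_inner_smul_left, real_inner_self_eq_norm_sq, real_inner_comm,
      inner_eq]
    ring
  have norm_eq : ‖s • v i - v j‖ = ‖v i‖ * √(s ^ 2 - 2 * c * s + 1) := by
    rw [← Real.sqrt_sq (norm_nonneg (s • v i - v j)), norm_sub_sq_real, real_inner_smul_left,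
      inner_eq, norm_smul, hv j, ← Real.sqrt_sq hr.le, ← Real.sqrt_mul (by positivity),
      Real.sqrt_sq hr.le, mul_pow, Real.norm_eq_abs, sq_abs]
    ring_nf
  rw [sub_inner_eq, norm_eq, unitSphereAttraction]
  field_simp

end RadialAttraction

section CentralConfiguration

variable {ι : Type*} [Fintype ι] [DecidableEq ι] {d : ℕ}

theorem IsCentralConfiguration.of_similarity {e : ℕ} {q : ι → EuclideanSpace ℝ (Fin d)}
    {m : ι → ℝ} (p : EuclideanSpace ℝ (Fin e)) {a : ℝ}
    (ha : a ≠ 0) (R : EuclideanSpace ℝ (Fin d) →ₗᵢ[ℝ] EuclideanSpace ℝ (Fin e))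
    (h : IsCentralConfiguration (fun i => p + a • R (q i)) m) :
    IsCentralConfiguration q m := by
  obtain ⟨c, hc⟩ := h
  refine ⟨|a| ^ 3 * c, fun i => R.injective ?_⟩
  have scale_term (μ : ℝ) (x : EuclideanSpace ℝ (Fin d)) :
      R ((μ * (1 / ‖x‖ ^ 3 - |a| ^ 3 * c)) • x) =
        (|a| ^ 3 / a) • (μ * (1 / ‖a • R x‖ ^ 3 - c)) • (a • R x) := by
    have ha' : |a| ≠ 0 := abs_ne_zero.2 ha
    rw [norm_smul, R.norm_map, Real.norm_eq_abs, mul_pow, ← one_div_mul_one_div, map_smul,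
      smul_smul, smul_smul]
    congr 1
    field_simp
  have diff_eq (j : ι) : p + a • R (q j) - (p + a • R (q i)) = a • R (q j - q i) := by
    rw [map_sub, smul_sub, add_sub_add_left_eq_sub]
  simp only [map_sum, map_zero, scale_term, ← Finset.smul_sum]
  rw [← smul_zero (|a| ^ 3 / a), ← hc i]
  simp only [diff_eq]

theorem IsCentralConfiguration.exists_sum_inner_eq {q : ι → EuclideanSpace ℝ (Fin d)}
    {m : ι → ℝ} (h : IsCentralConfiguration q m) :
    ∃ c : ℝ, ∀ i y, ∑ j, m j * (⟪q j - q i, y⟫ / ‖q j - q i‖ ^ 3) =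
      c * ∑ j, m j * ⟪q j - q i, y⟫ := by
  obtain ⟨c, hc⟩ := h
  refine ⟨c, fun i y => ?_⟩
  have hi := hc i
  rw [Finset.sum_erase _ (by simp)] at hi
  rw [← sub_eq_zero, Finset.mul_sum, ← Finset.sum_sub_distrib, ← inner_zero_left (𝕜 := ℝ) y, ← hi,
    sum_inner]
  refine Finset.sum_congr rfl fun j _ => ?_
  rw [real_inner_smul_left]
  ring

theorem IsCentralConfiguration.mass_relation {v : ι → EuclideanSpace ℝ (Fin d)}
    (hv : ∑ j, v j = 0) {t μ₁ μ₂ : ℝ} (ht : 0 < t)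
    (h : IsCentralConfiguration (Sum.elim v fun j => t • v j)
      (Sum.elim (fun _ => μ₁) fun _ => μ₂)) (i : ι) :
    t ^ 3 * (radialAttraction v i 1 - radialAttraction v i t) * μ₁ =
      (radialAttraction v i 1 - radialAttraction v i t⁻¹) * μ₂ := by
  obtain ⟨c, hc⟩ := h.exists_sum_inner_eq
  have balance {r : ℝ} {k : ι ⊕ ι} (hr : 0 < r)
      (hk : Sum.elim v (fun j => t • v j) k = r • v i) :
      μ₁ * radialAttraction v i r + μ₂ * (radialAttraction v i (r / t) / t ^ 3) =
        c * (Fintype.card ι * (μ₁ + μ₂) * ⟪v i, v i⟫) := by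
    have attraction := sum_inner_div_norm_cube v i one_pos hr.ne'
    have total := sum_inner_smul_sub hv 1 (r • v i) (v i)
    simp only [one_smul, one_pow, div_one] at attraction total
    have key := hc k (v i)
    simp only [Fintype.sum_sum_type, Sum.elim_inl, Sum.elim_inr, hk, ← Finset.mul_sum,
      attraction, total, sum_inner_div_norm_cube v i ht hr.ne', sum_inner_smul_sub hv,
      real_inner_smul_left] at key
    refine mul_left_cancel₀ hr.ne' ?_
    linear_combination -key
  have outer := balance (k := .inl i) one_pos (one_smul ℝ _).symm
  have inner := balance (k := .inr i) ht rfl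
  rw [div_self ht.ne'] at inner
  field_simp at inner outer
  rw [← one_div]
  linear_combination outer - inner

end CentralConfiguration

theorem unitSphereAttraction_one (s : ℝ) :
    unitSphereAttraction 1 s = (s - 1) / (s * |s - 1| ^ 3) := by
  rw [unitSphereAttraction, ← Real.sqrt_sq_eq_abs]
  ring_nf

theorem unitSphereAttraction_neg_one (s : ℝ) :
    unitSphereAttraction (-1) s = (s + 1) / (s * |s + 1| ^ 3) := by
  rw [unitSphereAttraction, ← Real.sqrt_sq_eq_abs]
  ring_nf

theorem unitSphereAttraction_one_of_one_lt {s : ℝ} (hs : 1 < s) :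
    unitSphereAttraction 1 s = 1 / (s * (s - 1) ^ 2) := by
  have : 0 < s - 1 := sub_pos.2 hs
  rw [unitSphereAttraction_one, abs_of_pos this]
  field_simp

theorem unitSphereAttraction_nonneg {c s : ℝ} (hs : 0 ≤ s) (hcs : c ≤ s) :
    0 ≤ unitSphereAttraction c s :=
  div_nonneg (sub_nonneg.2 hcs) (by positivity)

theorem unitSphereAttraction_le_one_div_mul_sq {c s : ℝ} (hc : |c| ≤ 1) (hs : 1 < s) :
    unitSphereAttraction c s ≤ 1 / (s * (s - 1) ^ 2) := by
  obtain ⟨hc₁, hc₂⟩ := abs_le.1 hc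
  set D := s ^ 2 - 2 * c * s + 1
  have le_dist_sq : (s - 1) ^ 2 ≤ D := by nlinarith
  have : 0 < s - 1 := sub_pos.2 hs
  have dist_sq_pos : 0 < D := by nlinarith
  have radial_le_dist : s - c ≤ √D := Real.le_sqrt_of_sq_le (by nlinarith)
  calc unitSphereAttraction c s ≤ √D / (s * √D ^ 3) := by unfold unitSphereAttraction; gcongr
    _ = 1 / (s * D) := by
      rw [pow_succ, Real.sq_sqrt dist_sq_pos.le]
      field_simp
    _ ≤ 1 / (s * (s - 1) ^ 2) := by gcongr

theorem unitSphereAttraction_continuousOn {c : ℝ} (hc : c ≤ 1) :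
    ContinuousOn (unitSphereAttraction c) (Set.Ioi 1) := by
  unfold unitSphereAttraction
  refine ContinuousOn.div (by fun_prop) (by fun_prop) fun s hs => ?_
  rw [Set.mem_Ioi] at hs
  have : 0 < s ^ 2 - 2 * c * s + 1 := by nlinarith
  positivity

theorem unitSphereAttraction_one_strictAntiOn :
    StrictAntiOn (unitSphereAttraction 1) (Set.Ioi 1) := by
  intro x hx y hy hxy
  rw [Set.mem_Ioi] at hx hy
  rw [unitSphereAttraction_one_of_one_lt hx, unitSphereAttraction_one_of_one_lt hy]
  have : 0 < x - 1 := sub_pos.2 hx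
  gcongr

theorem sq_sub_two_mul_mul_add_one_pos {c s : ℝ} (hc : c < 1) (hs : 0 < s) :
    0 < s ^ 2 - 2 * c * s + 1 := by
  nlinarith [sq_nonneg (s - 1), mul_pos (sub_pos.2 hc) hs]

theorem antitoneOn_sub_div_mul_sq_add_one {c : ℝ} (hc : c ≤ 1 / 2) :
    AntitoneOn (fun s : ℝ => (s - c) / (s * (s ^ 2 - 2 * c * s + 1))) (Set.Ici 1) := by
  have dist_sq_pos {s : ℝ} (hs : 1 ≤ s) : 0 < s ^ 2 - 2 * c * s + 1 :=
    sq_sub_two_mul_mul_add_one_pos (by linarith) (by linarith)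
  intro x hx y hy hxy
  rw [Set.mem_Ici] at hx hy
  have hx' := dist_sq_pos hx
  have hy' := dist_sq_pos hy
  simp only
  rw [div_le_div_iff₀ (by positivity) (by positivity), ← sub_nonneg]
  have secant : 0 ≤ x * y * (x + y) - 2 * c * (x * y) - c * (x ^ 2 + x * y + y ^ 2) +
      2 * c ^ 2 * (x + y) - c := by
    obtain ⟨a, ha, rfl⟩ : ∃ a, 0 ≤ a ∧ x = 1 + a := ⟨x - 1, by linarith, by ring⟩
    obtain ⟨b, hb, rfl⟩ : ∃ b, 0 ≤ b ∧ y = 1 + b := ⟨y - 1, by linarith, by ring⟩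
    obtain ⟨e, he, rfl⟩ : ∃ e, 0 ≤ e ∧ c = 1 / 2 - e := ⟨1 / 2 - c, by linarith, by ring⟩
    have : 0 ≤ (a + b + (a ^ 2 + b ^ 2 + 5 * (a * b)) / 2 + a * b * (a + b)) +
        e * (2 + 3 * a + 3 * b + a ^ 2 + b ^ 2 + 3 * (a * b)) + 2 * e ^ 2 * (2 + a + b) := by
      positivity
    linear_combination this
  linear_combination mul_nonneg (sub_nonneg.2 hxy) secant

theorem unitSphereAttraction_antitoneOn {c : ℝ} (hc : c ≤ 1 / 2) :
    AntitoneOn (unitSphereAttraction c) (Set.Ici 1) := by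
  have dist_sq_pos {s : ℝ} (hs : 1 ≤ s) : 0 < s ^ 2 - 2 * c * s + 1 :=
    sq_sub_two_mul_mul_add_one_pos (by linarith) (by linarith)
  have eq_mul {s : ℝ} (hs : 1 ≤ s) : unitSphereAttraction c s =
      (s - c) / (s * (s ^ 2 - 2 * c * s + 1)) * (1 / √(s ^ 2 - 2 * c * s + 1)) := by
    rw [unitSphereAttraction, pow_succ, Real.sq_sqrt (dist_sq_pos hs).le, ← mul_assoc,
      div_mul_div_comm, mul_one]
  intro x hx y hy hxy
  have hdiv := antitoneOn_sub_div_mul_sq_add_one hc hx hy hxy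
  rw [Set.mem_Ici] at hx hy
  have hx' := dist_sq_pos hx
  rw [eq_mul hx, eq_mul hy]
  gcongr ?_ * (1 / √?_)
  · exact div_nonneg (by linarith) (by positivity)
  · nlinarith

theorem unitSphereAttraction_one_add_neg_one_le {u : ℝ} (h0 : 0 < u) (h1 : u < 1) :
    unitSphereAttraction 1 u + unitSphereAttraction (-1) u ≤ -4 := by
  have hm : 0 < 1 - u := sub_pos.2 h1
  have hu : 0 < 1 - u ^ 2 := by nlinarith
  have sum_eq : unitSphereAttraction 1 u + unitSphereAttraction (-1) u =
      -(4 / (1 - u ^ 2) ^ 2) := by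
    rw [unitSphereAttraction_one, unitSphereAttraction_neg_one, abs_sub_comm, abs_of_pos hm,
      abs_of_pos (by positivity), show 1 - u ^ 2 = (1 - u) * (1 + u) by ring]
    field_simp
    ring
  rw [sum_eq, neg_le_neg_iff, le_div_iff₀ (by positivity)]
  nlinarith

theorem one_div_add_one_div_le_two {c : ℝ} (h0 : 0 ≤ c) (h1 : c ≤ 1 / 2) (u : ℝ) :
    1 / (u ^ 2 - 2 * c * u + 1) + 1 / (u ^ 2 + 2 * c * u + 1) ≤ 2 := by
  have hm : 0 < u ^ 2 - 2 * c * u + 1 := by nlinarith [sq_nonneg (u - c)]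
  have hp : 0 < u ^ 2 + 2 * c * u + 1 := by nlinarith [sq_nonneg (u + c)]
  rw [div_add_div _ _ hm.ne' hp.ne', div_le_iff₀ (by positivity)]
  have : 0 ≤ u ^ 2 * (1 - 4 * c ^ 2 + u ^ 2) :=
    mul_nonneg (sq_nonneg u) (by nlinarith [sq_nonneg u])
  linear_combination 2 * this

theorem one_div_sqrt_cube_add_one_div_sqrt_cube_le {x y : ℝ} (hx : 0 < x) (hxy : x ≤ y) :
    1 / √x ^ 3 + 1 / √y ^ 3 ≤ (1 / x + 1 / y) / √x := by
  have hy : 0 < y := hx.trans_le hxy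
  have sqrt_cube {z : ℝ} (hz : 0 < z) : 1 / √z ^ 3 = 1 / z / √z := by
    rw [pow_succ, Real.sq_sqrt hz.le, div_div]
  rw [sqrt_cube hx, sqrt_cube hy, add_div]
  gcongr

theorem unitSphereAttraction_add_unitSphereAttraction_neg_le {c u : ℝ} (hc0 : 0 ≤ c)
    (hc : c ≤ 1 / 2) (hu : 0 < u) :
    unitSphereAttraction c u + unitSphereAttraction (-c) u ≤ 2 / √(1 - c ^ 2) := by
  set x := u ^ 2 - 2 * c * u + 1 with hx
  set y := u ^ 2 + 2 * c * u + 1 with hy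
  have hxy : x ≤ y := by
    have : 0 ≤ c * u := by positivity
    linarith
  have hcx : 1 - c ^ 2 ≤ x := by nlinarith [sq_nonneg (u - c)]
  have hc' : 0 < 1 - c ^ 2 := by nlinarith
  have x_pos : 0 < x := hc'.trans_le hcx
  calc unitSphereAttraction c u + unitSphereAttraction (-c) u
      = 1 / √x ^ 3 + 1 / √y ^ 3 - c / u * (1 / √x ^ 3 - 1 / √y ^ 3) := by
        rw [unitSphereAttraction, unitSphereAttraction, ← hx,
          show u ^ 2 - 2 * -c * u + 1 = y by rw [hy]; ring]
        have := x_pos.trans_le hxy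
        field_simp
        ring
    _ ≤ 1 / √x ^ 3 + 1 / √y ^ 3 := by
        have : 1 / √y ^ 3 ≤ 1 / √x ^ 3 := by gcongr
        exact sub_le_self _ (mul_nonneg (by positivity) (sub_nonneg.2 this))
    _ ≤ (1 / x + 1 / y) / √x := one_div_sqrt_cube_add_one_div_sqrt_cube_le x_pos hxy
    _ ≤ 2 / √(1 - c ^ 2) := by
        gcongr
        exact one_div_add_one_div_le_two hc0 hc u

theorem norm_cubeVertex (s : Fin 3 → Bool) : ‖cubeVertex s‖ = √3 := by
  have sq_coord (k : Fin 3) : (cubeVertex s k) ^ 2 = 1 := by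
    cases h : s k <;> simp [cubeVertex, h]
  simp [EuclideanSpace.norm_eq, sq_coord]

theorem sum_cubeVertex : ∑ s, cubeVertex s = 0 := by
  have antipodal : ∑ s, cubeVertex s = ∑ s, -cubeVertex s := by
    refine Fintype.sum_equiv (Equiv.piCongrRight fun _ => Equiv.boolNot) _ _ fun s => ?_
    ext k
    cases h : s k <;> simp [cubeVertex, h]
  have := IsAddTorsionFree.of_isTorsionFree ℝ (EuclideanSpace ℝ (Fin 3))
  rwa [Finset.sum_neg_distrib, self_eq_neg] at antipodal

theorem sum_fin_three_bool {M : Type*} [AddCommMonoid M] (F : (Fin 3 → Bool) → M) :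
    ∑ s, F s = ∑ x : Bool, ∑ y : Bool, ∑ z : Bool, F ![x, y, z] := by
  rw [← Fintype.sum_prod_type', ← Fintype.sum_prod_type']
  refine (Fintype.sum_bijective (fun x : (Bool × Bool) × Bool => ![x.1.1, x.1.2, x.2]) ?_ _ _
    fun _ => rfl).symm
  decide

theorem sum_apply_inner_cubeVertex (f : ℝ → ℝ) :
    ∑ s, f ⟪cubeVertex fun _ => true, cubeVertex s⟫ = f 3 + 3 * f 1 + 3 * f (-1) + f (-3) := by
  have inner_eq (x y z : Bool) : ⟪cubeVertex fun _ => true, cubeVertex ![x, y, z]⟫ =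
      (if x then 1 else -1) + (if y then 1 else -1) + (if z then 1 else -1) := by
    cases x <;> cases y <;> cases z <;> simp [cubeVertex, PiLp.inner_apply, Fin.sum_univ_three]
  simp only [sum_fin_three_bool, Fintype.sum_bool, inner_eq, if_true, Bool.false_eq_true, if_false]
  ring_nf

/-- The radial attraction, divided by `s`, of a cube inscribed in the unit sphere on the point at
distance `s` from the center on the ray through one of its vertices: the eight vertices make
angles of cosine `1`, `1 / 3`, `-1 / 3` and `-1` with that ray, with multiplicities `1`, `3`, `3`
and `1`. -/
noncomputable def cubeAttraction (s : ℝ) : ℝ :=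
  unitSphereAttraction 1 s + 3 * unitSphereAttraction (1 / 3) s +
    3 * unitSphereAttraction (-(1 / 3)) s + unitSphereAttraction (-1) s

theorem radialAttraction_cubeVertex (s : ℝ) :
    radialAttraction cubeVertex (fun _ => true) s = (√3)⁻¹ * cubeAttraction s := by
  have ne_zero : cubeVertex (fun _ => true) ≠ 0 := norm_ne_zero_iff.1 (by simp [norm_cubeVertex])
  have norm_eq (j : Fin 3 → Bool) : ‖cubeVertex j‖ = ‖cubeVertex fun _ => true‖ := by
    rw [norm_cubeVertex, norm_cubeVertex]
  rw [radialAttraction_eq_sum_unitSphereAttraction ne_zero norm_eq,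
    sum_apply_inner_cubeVertex fun x => unitSphereAttraction (x / _) s, norm_cubeVertex,
    Real.sq_sqrt zero_le_three, cubeAttraction]
  norm_num

theorem IsNestedCubes.mass_relation {t μ₁ μ₂ : ℝ}
    {q : (Fin 3 → Bool) ⊕ (Fin 3 → Bool) → EuclideanSpace ℝ (Fin 3)}
    (hq : IsNestedCubes t q) (ht : 0 < t) (h : IsCentralConfiguration q (cubeMasses μ₁ μ₂)) :
    t ^ 3 * (cubeAttraction 1 - cubeAttraction t) * μ₁ =
      (cubeAttraction 1 - cubeAttraction t⁻¹) * μ₂ := by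
  obtain ⟨p, a, R, ha, outer, inner⟩ := hq
  have q_eq : q = fun i => p + a • R.toLinearIsometry
      (Sum.elim cubeVertex (fun s => t • cubeVertex s) i) := by
    ext1 (s | s)
    · exact outer s
    · simp [inner, outer, smul_comm t a]
  have relation := (IsCentralConfiguration.of_similarity p ha.ne' _ (q_eq ▸ h)).mass_relation
    sum_cubeVertex ht fun _ => true
  simp only [radialAttraction_cubeVertex, ← mul_sub] at relation
  refine mul_left_cancel₀ (inv_ne_zero (Real.sqrt_ne_zero'.2 zero_lt_three)) ?_
  linear_combination relation

theorem cubeAttraction_strictAntiOn : StrictAntiOn cubeAttraction (Set.Ioi 1) := by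
  intro x hx y hy hxy
  have antitone {c : ℝ} (hc : c ≤ 1 / 2) : unitSphereAttraction c y ≤ unitSphereAttraction c x :=
    unitSphereAttraction_antitoneOn hc (Set.mem_Ioi.1 hx).le (Set.mem_Ioi.1 hy).le hxy.le
  have h₁ := unitSphereAttraction_one_strictAntiOn hx hy hxy
  have h₂ := antitone (c := 1 / 3) (by norm_num)
  have h₃ := antitone (c := -(1 / 3)) (by norm_num)
  have h₄ := antitone (c := -1) (by norm_num)
  unfold cubeAttraction
  linarith

theorem cubeAttraction_continuousOn : ContinuousOn cubeAttraction (Set.Ioi 1) := by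
  have h₁ := unitSphereAttraction_continuousOn (c := 1) le_rfl
  have h₂ := unitSphereAttraction_continuousOn (c := 1 / 3) (by norm_num)
  have h₃ := unitSphereAttraction_continuousOn (c := -(1 / 3)) (by norm_num)
  have h₄ := unitSphereAttraction_continuousOn (c := -1) (by norm_num)
  unfold cubeAttraction
  fun_prop

theorem cubeAttraction_le_eight_div {s : ℝ} (hs : 1 < s) :
    cubeAttraction s ≤ 8 / (s * (s - 1) ^ 2) := by
  have vertex_le {c : ℝ} (hc : |c| ≤ 1) := unitSphereAttraction_le_one_div_mul_sq hc hs
  have h₁ := vertex_le (c := 1) (by norm_num)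
  have h₂ := vertex_le (c := 1 / 3) (by norm_num [abs_of_pos])
  have h₃ := vertex_le (c := -(1 / 3)) (by norm_num [abs_of_pos])
  have h₄ := vertex_le (c := -1) (by norm_num)
  rw [cubeAttraction]
  linear_combination h₁ + 3 * h₂ + 3 * h₃ + h₄

theorem one_div_le_cubeAttraction {s : ℝ} (hs : 1 < s) :
    1 / (s * (s - 1) ^ 2) ≤ cubeAttraction s := by
  have nonneg {c : ℝ} (hc : c ≤ 1) : 0 ≤ unitSphereAttraction c s :=
    unitSphereAttraction_nonneg (by linarith) (by linarith)
  have h₂ := nonneg (c := 1 / 3) (by norm_num)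
  have h₃ := nonneg (c := -(1 / 3)) (by norm_num)
  have h₄ := nonneg (c := -1) (by norm_num)
  rw [cubeAttraction, unitSphereAttraction_one_of_one_lt hs]
  linarith

theorem cubeAttraction_one :
    cubeAttraction 1 = 2 / √(4 / 3) ^ 3 + 4 / √(8 / 3) ^ 3 + 1 / 4 := by
  rw [cubeAttraction, unitSphereAttraction_one, unitSphereAttraction_neg_one,
    unitSphereAttraction, unitSphereAttraction]
  norm_num
  ring

theorem twelve_fifths_lt_cubeAttraction_one : 12 / 5 < cubeAttraction 1 := by
  have h₁ : √(4 / 3) ≤ 7 / 6 := Real.sqrt_le_iff.2 (by norm_num)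
  have h₂ : √(8 / 3) ≤ 41 / 25 := Real.sqrt_le_iff.2 (by norm_num)
  calc (12 / 5 : ℝ) < 2 / (7 / 6) ^ 3 + 4 / (41 / 25) ^ 3 + 1 / 4 := by norm_num
    _ ≤ cubeAttraction 1 := by rw [cubeAttraction_one]; gcongr

theorem cubeAttraction_one_le_seven : cubeAttraction 1 ≤ 7 := by
  have h₁ : 1 ≤ √(4 / 3) := Real.one_le_sqrt.2 (by norm_num)
  have h₂ : 1 ≤ √(8 / 3) := Real.one_le_sqrt.2 (by norm_num)
  calc cubeAttraction 1 ≤ 2 / 1 ^ 3 + 4 / 1 ^ 3 + 1 / 4 := by rw [cubeAttraction_one]; gcongr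
    _ ≤ 7 := by norm_num

theorem exists_one_lt_cubeAttraction_eq : ∃ s, 1 < s ∧ cubeAttraction s = cubeAttraction 1 := by
  have near : cubeAttraction 1 ≤ cubeAttraction (5 / 4) :=
    calc cubeAttraction 1 ≤ 7 := cubeAttraction_one_le_seven
      _ ≤ 1 / (5 / 4 * (5 / 4 - 1) ^ 2) := by norm_num
      _ ≤ cubeAttraction (5 / 4) := one_div_le_cubeAttraction (by norm_num)
  have far : cubeAttraction 3 ≤ cubeAttraction 1 :=
    calc cubeAttraction 3 ≤ 8 / (3 * (3 - 1) ^ 2) := cubeAttraction_le_eight_div (by norm_num)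
      _ ≤ 12 / 5 := by norm_num
      _ ≤ cubeAttraction 1 := twelve_fifths_lt_cubeAttraction_one.le
  obtain ⟨s, hs, h⟩ := intermediate_value_Icc' (by norm_num : (5 / 4 : ℝ) ≤ 3)
    (cubeAttraction_continuousOn.mono fun s hs => Set.mem_Ioi.2 (by linarith [hs.1])) ⟨far, near⟩
  exact ⟨s, by linarith [hs.1], h⟩

theorem cubeAttraction_lt_cubeAttraction_one {u : ℝ} (h0 : 0 < u) (h1 : u < 1) :
    cubeAttraction u < cubeAttraction 1 := by
  have diagonal := unitSphereAttraction_one_add_neg_one_le h0 h1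
  have off_diagonal : unitSphereAttraction (1 / 3) u + unitSphereAttraction (-(1 / 3)) u ≤
      2 / (15 / 16) :=
    calc _ ≤ 2 / √(1 - (1 / 3) ^ 2) :=
          unitSphereAttraction_add_unitSphereAttraction_neg_le (by norm_num) (by norm_num) h0
      _ ≤ 2 / (15 / 16) := by
          gcongr
          exact Real.le_sqrt_of_sq_le (by norm_num)
  have self := twelve_fifths_lt_cubeAttraction_one
  rw [cubeAttraction]
  linarith

theorem sign_mul_eq_of_mul_eq_mul {a b x y : ℝ} (ha : 0 < a) (h : a * x = b * y)
    (hxy : x ≠ 0 ∨ y ≠ 0) : SignType.sign (x * y) = SignType.sign b := by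
  have hy : y ≠ 0 := by
    rintro rfl
    simp_all [ha.ne']
  have product_eq : x * y = b * (y ^ 2 / a) := by
    field_simp
    linear_combination h
  rw [product_eq, sign_mul, sign_pos (show 0 < y ^ 2 / a by positivity), mul_one]

theorem IsNestedCubes.sign_mass_mul {t μ₁ μ₂ : ℝ}
    {q : (Fin 3 → Bool) ⊕ (Fin 3 → Bool) → EuclideanSpace ℝ (Fin 3)}
    (hq : IsNestedCubes t q) (h0 : 0 < t) (h1 : t < 1) (hμ : μ₁ ≠ 0 ∨ μ₂ ≠ 0)
    (h : IsCentralConfiguration q (cubeMasses μ₁ μ₂)) :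
    SignType.sign (μ₁ * μ₂) = SignType.sign (cubeAttraction 1 - cubeAttraction t⁻¹) :=
  have := sub_pos.2 (cubeAttraction_lt_cubeAttraction_one h0 h1)
  sign_mul_eq_of_mul_eq_mul (by positivity) (hq.mass_relation h0 h) hμ

theorem mainTheorem7 :
    ∃ δ : ℝ, 0 < δ ∧ δ < 1 ∧
      ∀ (t : ℝ) (q : (Fin 3 → Bool) ⊕ (Fin 3 → Bool) → EuclideanSpace ℝ (Fin 3))
        (μ₁ μ₂ : ℝ),
        IsNestedCubes t q →
        (μ₁ ≠ 0 ∨ μ₂ ≠ 0) →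
        IsCentralConfiguration q (cubeMasses μ₁ μ₂) →
        (t ∈ Set.Ioo 0 δ → 0 < μ₁ * μ₂) ∧
        (t ∈ Set.Ioo δ 1 → μ₁ * μ₂ < 0) := by
  obtain ⟨s, hs, critical⟩ := exists_one_lt_cubeAttraction_eq
  have s_pos : 0 < s := one_pos.trans hs
  refine ⟨s⁻¹, inv_pos.2 s_pos, inv_lt_one_of_one_lt₀ hs, fun t q μ₁ μ₂ hq hμ hc => ⟨?_, ?_⟩⟩
  · rintro ⟨ht, hts⟩
    have hst : s < t⁻¹ := (lt_inv_comm₀ ht s_pos).1 hts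
    have ht1 : t < 1 := hts.trans (inv_lt_one_of_one_lt₀ hs)
    rw [← sign_eq_one_iff, hq.sign_mass_mul ht ht1 hμ hc, ← critical, sign_eq_one_iff,
      sub_pos]
    exact cubeAttraction_strictAntiOn hs (hs.trans hst) hst
  · rintro ⟨hst, ht1⟩
    have ht : 0 < t := (inv_pos.2 s_pos).trans hst
    have hts : t⁻¹ < s := (inv_lt_comm₀ s_pos ht).1 hst
    rw [← sign_eq_neg_one_iff, hq.sign_mass_mul ht ht1 hμ hc, ← critical,
      sign_eq_neg_one_iff, sub_neg]
    exact cubeAttraction_strictAntiOn ((one_lt_inv₀ ht).2 ht1) hs hts
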